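/- For integers $p\ge 1$, $q\ge 2$ let $$R_{p,q}=\sum_{n=1}^{\infty}\frac{H_{n-1}^{(p)}}{(n-1/2)^q},\qquad H_n^{(p)}=\sum_{k=1}^{n}\frac1{k^p},\quad H_0^{(p)}=0,$$ and for integers $s\ge 2$ let $\tilde t(s)=\sum_{n=1}^{\infty}(n-1/2)^{-s}$; let $\zeta(s)$ be the Riemann zeta function, and put, by convention, $\zeta(1):=-2\ln 2$ and $\tilde t(1):=0$ wherever they occur. For a two-parameter family $\Omega_{p,q}$ of real numbers and $m\ge 1$ write $$\lambda_m(\Omega_{p,q})=\sum_{\substack{i+j=m-1\\ i,j\ge 0}}\binom{p+i-1}{i}\binom{q+j-1}{j}\,\Omega_{p+i,q+j}.$$ (Thus, for instance, $\lambda_p((-1)^m\zeta(m)\tilde t(q))$ is $\lambda_p(\Omega_{m,q})$ for the family $\Omega_{a,b}=(-1)^a\zeta(a)\tilde t(b)$.) **Theorem.** The series $R_{p,q}$ converge for all $p\ge1$, $q\ge2$. For all integers $m,p\ge 1$ and $q\ge 2$, $$(-1)^{m-1}\lambda_p(R_{m,q})+(-1)^{p-1}\lambda_m(R_{p,q})\in\mathbb{Q}[\ln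 2,\zeta(2),\zeta(3),\zeta(4),\dots],$$ and explicitly $$\begin{aligned}(-1)^{m-1}\lambda_p(R_{m,q})+(-1)^{p-1}\lambda_m(R_{p,q})={}&\binom{m+p+q-2}{q-1}\tilde t(m+p+q-1)\\&+(-1)^m\lambda_p\big((-1)^m\zeta(m)\tilde t(q)\big)+(-1)^p\lambda_m\big((-1)^p\zeta(p)\tilde t(q)\big)\\&-\lambda_q\big(\tilde t(m)\tilde t(p)\big).\end{aligned}$$ -/

import Mathlib

noncomputable section

namespace EulerR

/-- The generalized harmonic number `H_n^{(r)} = ∑_{k=1}^n 1 / k^r`, with `H_0^{(r)} = 0`. -/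
def H (n r : ℕ) : ℝ := ∑ k ∈ Finset.Icc 1 n, 1 / (k : ℝ) ^ r

/-- The summand `H_{n-1}^{(p)} / (n - 1/2)^q` of the linear `R`-sum, meant for `n ≥ 1`. -/
def Rterm (p q n : ℕ) : ℝ := H (n - 1) p / ((n : ℝ) - 1 / 2) ^ q

/-- The linear sum `R_{p,q} = ∑_{n ≥ 1} H_{n-1}^{(p)} / (n - 1/2)^q`
(the index `n : ℕ` of the series stands for `n + 1`). -/
def R (p q : ℕ) : ℝ := ∑' n : ℕ, Rterm p q (n + 1)

/-- The value of the Riemann zeta function at a natural number, as a real number. -/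
def zetaValue (s : ℕ) : ℝ := (riemannZeta (s : ℂ)).re

/-- For `s ≥ 2` the number `zetaValue s` is the value of the Riemann zeta function. -/
theorem ofReal_zetaValue {s : ℕ} (hs : 2 ≤ s) :
    ((zetaValue s : ℝ) : ℂ) = riemannZeta (s : ℂ) := by
  have h : riemannZeta (s : ℂ) = ((∑' n : ℕ, 1 / (n : ℝ) ^ s : ℝ) : ℂ) := by
    rw [zeta_nat_eq_tsum_of_gt_one (by omega)]
    push_cast
    rfl
  rw [zetaValue, h, Complex.ofReal_re]

/-- `ζ(s)` with the convention `ζ(1) := -2 ln 2`. -/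
def zeta (s : ℕ) : ℝ := if s = 1 then -2 * Real.log 2 else zetaValue s

/-- `t̃(s) = ∑_{n ≥ 1} 1 / (n - 1/2)^s` for `s ≥ 2`, with the convention `t̃(1) := 0`
(the index `n : ℕ` of the series stands for `n + 1`). -/
def tTilde (s : ℕ) : ℝ :=
  if s = 1 then 0 else ∑' n : ℕ, 1 / (((n + 1 : ℕ) : ℝ) - 1 / 2) ^ s

/-- The transformation
`λ_m(Ω_{p,q}) = ∑_{i+j=m-1} C(p+i-1, i) C(q+j-1, j) Ω_{p+i,q+j}`, for `m, p, q ≥ 1`. -/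
def lam (m : ℕ) (Ω : ℕ → ℕ → ℝ) (p q : ℕ) : ℝ :=
  ∑ ij ∈ Finset.HasAntidiagonal.antidiagonal (m - 1),
    ((p + ij.1 - 1).choose ij.1 : ℝ) * ((q + ij.2 - 1).choose ij.2 : ℝ) *
      Ω (p + ij.1) (q + ij.2)

/-- The ring `ℚ[ln 2, ζ(2), ζ(3), ζ(4), …]` of rational polynomial expressions in `ln 2` and
the values of the Riemann zeta function at the integers `k ≥ 2`. -/
def logZetaRing : Subalgebra ℚ ℝ :=
  Algebra.adjoin ℚ ({Real.log 2} ∪ {x : ℝ | ∃ k : ℕ, 2 ≤ k ∧ x = zetaValue k})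

end EulerR

end

/-!
The formula is the residue theorem for the function
`(∑ a, 1 / (a - s) ^ m) * (∑ b, 1 / (b - s) ^ p) / (1 / 2 - s) ^ q`, with `a` and `b` running over
the positive integers. To stay elementary, the sums are cut off at `N`, so that the function is
rational, and `N` tends to infinity only in the resulting identity.

For a single triple of poles, `λ_m` is what the residue at `a` produces: it is the coefficient of
`u ^ (m - 1)` in `1 / ((b - a - u) ^ p * (c - a - u) ^ q)`. With these coefficients taken in the
ring of formal power series, the vanishing of the sum of the residues (`residueSum_eq`) follows by
induction from `(b - a) / ((a - s) * (b - s)) = 1 / (a - s) - 1 / (b - s)`. Summing over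
`a` and `b` gives `sum_residues_eq_zero`, where the pairs `a = b` contribute poles of order `m + p`.
The inner sum `∑ b ≠ a, 1 / (b - a) ^ r` is a harmonic number `H_{a-1}^{(r)}` up to sign, plus a
truncation of `ζ(r)`; this is how `R` and the products `ζ t̃` arise in `truncated_formula`.

For exponent `1` the truncations diverge. The remedy is to subtract the constant
`∑_{b ≤ N} 1 / (b - 1/2)` from a factor with exponent `1`. This keeps the sum of the residues zero,
since `q ≥ 2`; it turns `t̃(1)` into `0` and `ζ(1)` into `lim (H_N - ∑_{b ≤ N} 1 / (b - 1/2))`,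
which is `-2 ln 2`. The limit is then taken by dominated convergence (`tendsto_zetaTTrunc`), and
membership in the ring follows from `t̃(s) = (2 ^ s - 1) ζ(s)`.
-/

noncomputable section

namespace EulerR

/-! ### Power series of `1 / (x - u)` -/

section Residues

open PowerSeries Finset

variable {K : Type*} [Field K]

/-- The Taylor expansion of `1 / (x - X)` at `0`, for `x ≠ 0`. -/
def recip (x : K) : PowerSeries K := (C x - X)⁻¹

theorem sub_mul_recip {x : K} (hx : x ≠ 0) : (C x - X) * recip x = 1 :=
  PowerSeries.mul_inv_cancel _ (by simpa using hx)

theorem recip_eq_mk {x : K} (hx : x ≠ 0) :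
    recip x = C x⁻¹ * rescale x⁻¹ (mk 1 : PowerSeries K) := by
  rw [recip, eq_comm, PowerSeries.eq_inv_iff_mul_eq_one (by simpa using hx)]
  have h := congrArg (rescale x⁻¹) (PowerSeries.mk_one_mul_one_sub_eq_one K)
  rw [map_mul, map_one, map_sub, map_one, rescale_X] at h
  rw [← h]
  have hc : (C x⁻¹ : PowerSeries K) * C x = 1 := by
    rw [← map_mul, inv_mul_cancel₀ hx, map_one]
  linear_combination (rescale x⁻¹ (mk 1 : PowerSeries K)) * hc

theorem coeff_recip_pow {x : K} (hx : x ≠ 0) {p : ℕ} (hp : 1 ≤ p) (i : ℕ) :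
    coeff i (recip x ^ p) = ((p + i - 1).choose i : K) * (1 / x ^ (p + i)) := by
  obtain ⟨d, rfl⟩ := Nat.exists_eq_add_of_le' hp
  rw [recip_eq_mk hx, mul_pow, ← map_pow, ← map_pow, mk_one_pow_eq_mk_choose_add, coeff_C_mul,
    coeff_rescale, coeff_mk, show d + 1 + i - 1 = d + i by omega,
    ← Nat.choose_symm_of_eq_add (a := d) (b := i) rfl]
  rw [one_div, ← inv_pow, add_assoc d 1 i, add_comm 1 i, ← add_assoc]
  ring

/-! ### Residues at three poles -/

/-- The sum of the residues of `s ↦ 1 / ((a - s) ^ m * (b - s) ^ p * (c - s) ^ q)` at `a`, `b`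
and `c`. The residue at `a` is `(-1) ^ m` times the coefficient of `u ^ (m - 1)` in
`1 / ((b - a - u) ^ p * (c - a - u) ^ q)`; the factor `X` turns it into the coefficient of
`u ^ m`, which is correctly `0` for `m = 0`. -/
def residueSum (m p q : ℕ) (a b c : K) : K :=
  (-1) ^ m * coeff m (X * (recip (b - a) ^ p * recip (c - a) ^ q))
    + (-1) ^ p * coeff p (X * (recip (a - b) ^ m * recip (c - b) ^ q))
    + (-1) ^ q * coeff q (X * (recip (a - c) ^ m * recip (b - c) ^ p))

theorem residueSum_swap_left (m p q : ℕ) (a b c : K) :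
    residueSum m p q a b c = residueSum p m q b a c := by
  simp only [residueSum, mul_comm (recip (a - c) ^ m)]
  ring

theorem residueSum_swap_right (m p q : ℕ) (a b c : K) :
    residueSum m p q a b c = residueSum m q p a c b := by
  simp only [residueSum, mul_comm (recip (b - a) ^ p)]
  ring

/-- The recurrence coming from `(b - a) / ((a - s) * (b - s)) = 1 / (a - s) - 1 / (b - s)`. -/
theorem sub_mul_residueSum (m p q : ℕ) {a b c : K} (hab : a ≠ b)
    (hac : q ≠ 0 → a ≠ c) (hbc : q ≠ 0 → b ≠ c) :
    (b - a) * residueSum (m + 1) (p + 1) q a b c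
      = residueSum (m + 1) p q a b c - residueSum m (p + 1) q a b c := by
  have key : ∀ (x : K) (_ : x ≠ 0) (n k : ℕ) (g : PowerSeries K),
      x * coeff (n + 1) (X * (recip x ^ (k + 1) * g))
        = coeff (n + 1) (X * (recip x ^ k * g)) + coeff n (X * (recip x ^ (k + 1) * g)) := by
    intro x hx n k g
    rw [← coeff_C_mul, ← coeff_succ_X_mul n (X * (recip x ^ (k + 1) * g)), ← map_add]
    congr 1
    linear_combination X * recip x ^ k * g * sub_mul_recip hx
  have h1 := key (b - a) (sub_ne_zero.2 hab.symm) m p (recip (c - a) ^ q)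
  have h2 := key (a - b) (sub_ne_zero.2 hab) p m (recip (c - b) ^ q)
  have h3 : (b - a) * coeff q (X * (recip (a - c) ^ (m + 1) * recip (b - c) ^ (p + 1)))
      = coeff q (X * (recip (a - c) ^ (m + 1) * recip (b - c) ^ p))
        - coeff q (X * (recip (a - c) ^ m * recip (b - c) ^ (p + 1))) := by
    rcases Nat.eq_zero_or_pos q with rfl | hq
    · simp
    · have ha := sub_mul_recip (sub_ne_zero.2 (hac hq.ne'))
      have hb := sub_mul_recip (sub_ne_zero.2 (hbc hq.ne'))
      rw [← coeff_C_mul, ← map_sub]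
      congr 1
      simp only [map_sub] at ha hb ⊢
      linear_combination X * recip (a - c) ^ m * recip (b - c) ^ p *
        (recip (a - c) * hb - recip (b - c) * ha)
  simp only [residueSum]
  rw [pow_succ (-1 : K) m, pow_succ (-1 : K) p]
  linear_combination (-1) ^ m * (-1) * h1 - (-1) ^ p * (-1) * h2 + (-1) ^ q * h3

/-- The residue theorem for `1 / ((a - s) ^ m * (b - s) ^ p * (c - s) ^ q)`: the residues add up
to `0`, except when the function is a single simple pole. -/
theorem residueSum_eq (m p q : ℕ) {a b c : K} (hab : m ≠ 0 → p ≠ 0 → a ≠ b)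
    (hac : m ≠ 0 → q ≠ 0 → a ≠ c) (hbc : p ≠ 0 → q ≠ 0 → b ≠ c) :
    residueSum m p q a b c = if m + p + q = 1 then -1 else 0 := by
  induction hn : m + p + q generalizing m p q a b c with
  | zero =>
    obtain ⟨rfl, rfl, rfl⟩ : m = 0 ∧ p = 0 ∧ q = 0 := by omega
    simp [residueSum]
  | succ n ih =>
    -- with two factors present, both terms of the recurrence have the same value by induction
    have two : ∀ (m p q : ℕ) (a b c : K), a ≠ b → (q ≠ 0 → a ≠ c) → (q ≠ 0 → b ≠ c) →
        m + 1 + (p + 1) + q = n + 1 → residueSum (m + 1) (p + 1) q a b c = 0 := by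
      intro m p q a b c hab hac hbc hn
      have h := sub_mul_residueSum m p q hab hac hbc
      rw [ih (m + 1) p q (fun _ _ => hab) (fun _ => hac) (fun _ => hbc) (by omega),
        ih m (p + 1) q (fun _ _ => hab) (fun _ => hac) (fun _ => hbc) (by omega), sub_self] at h
      exact (mul_eq_zero.1 h).resolve_left (sub_ne_zero.2 hab.symm)
    have one : ∀ (m : ℕ) (a b c : K), residueSum m 0 0 a b c = if m = 1 then -1 else 0 := by
      intro m a b c
      by_cases h1 : m = 1 <;> simp [residueSum, coeff_X, h1]
    rcases m with _ | m <;> rcases p with _ | p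
    · rw [residueSum_swap_right, residueSum_swap_left, one]
      congr 1
      simp; omega
    · rcases q with _ | q
      · rw [residueSum_swap_left, one]
        congr 1
        simp; omega
      · rw [residueSum_swap_left, residueSum_swap_right,
          two p q 0 b c a (hbc (by omega) (by omega)) (by simp) (by simp) (by omega),
          if_neg (by omega)]
    · rcases q with _ | q
      · rw [one]
        congr 1
        simp; omega
      · rw [residueSum_swap_right,
          two m q 0 a c b (hac (by omega) (by omega)) (by simp) (by simp) (by omega),
          if_neg (by omega)]
    · rw [two m p q a b c (hab (by omega) (by omega)) (hac (by omega)) (hbc (by omega)) (by omega),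
          if_neg (by omega)]

/-! ### Residues of a product of two finite sums of poles -/

/-- The coefficients of a regularized sum `∑ 1 / (x l - X) ^ p - δ` of translated poles. -/
theorem coeff_sum_recip_pow_sub {ι : Type*} (s : Finset ι) {x : ι → K} (hx : ∀ l ∈ s, x l ≠ 0)
    {p : ℕ} (hp : 1 ≤ p) (τ : K) (i : ℕ) :
    coeff i (∑ l ∈ s, recip (x l) ^ p - C (if p = 1 then τ else 0))
      = ((p + i - 1).choose i : K) *
        (∑ l ∈ s, 1 / x l ^ (p + i) - if p + i = 1 then τ else 0) := by
  rw [map_sub, map_sum, sum_congr rfl fun l hl => coeff_recip_pow (hx l hl) hp i, ← mul_sum,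
    mul_sub]
  congr 1
  rcases i with _ | i
  · simp
  · rw [if_neg (by omega : p + (i + 1) ≠ 1), coeff_C, if_neg (by omega), mul_zero]

/-- The residue theorem for `A m * A p / (c - s) ^ q`, where `A m` is the finite sum
`∑ l, 1 / (x l - s) ^ m` minus a constant `δ`. The coinciding poles of the two factors give the
third sum. -/
theorem sum_residues_eq_zero {ι : Type*} [DecidableEq ι] (s : Finset ι) {x : ι → K} {c : K}
    (hx : Set.InjOn x s) (hc : ∀ l ∈ s, x l ≠ c) {m p q : ℕ} (hm : 1 ≤ m) (hp : 1 ≤ p)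
    (hq : 2 ≤ q) (δm δp : K) :
    (-1) ^ m * ∑ k ∈ s, coeff m (X * ((∑ l ∈ s.erase k, recip (x l - x k) ^ p - C δp)
        * recip (c - x k) ^ q))
      + (-1) ^ p * ∑ k ∈ s, coeff p (X * ((∑ l ∈ s.erase k, recip (x l - x k) ^ m - C δm)
        * recip (c - x k) ^ q))
      + (-1) ^ (m + p) * ∑ k ∈ s, coeff (m + p) (X * recip (c - x k) ^ q)
      + (-1) ^ q * coeff q (X * ((∑ l ∈ s, recip (x l - c) ^ m - C δm)
        * (∑ l ∈ s, recip (x l - c) ^ p - C δp))) = 0 := by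
  have h1 : ∑ k ∈ s, ∑ l ∈ s.erase k, residueSum m p q (x k) (x l) c = 0 := by
    refine sum_eq_zero fun k hk => sum_eq_zero fun l hl => ?_
    rw [mem_erase] at hl
    rw [residueSum_eq m p q (fun _ _ h => hl.1 (hx hl.2 hk h.symm)) (fun _ _ => hc k hk)
      (fun _ _ => hc l hl.2), if_neg (by omega)]
  have h2 : ∀ r, 1 ≤ r → ∑ k ∈ s, residueSum r 0 q (x k) c c = 0 := by
    refine fun r hr => sum_eq_zero fun k hk => ?_
    rw [residueSum_eq r 0 q (by simp) (fun _ _ => hc k hk) (by simp), if_neg (by omega)]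
  have hmp := h2 (m + p) (by omega)
  have hm' := h2 m hm
  have hp' := h2 p hp
  have hswap : ∀ f : ι → ι → K, ∑ k ∈ s, ∑ l ∈ s.erase k, f k l
      = ∑ l ∈ s, ∑ k ∈ s.erase l, f k l := fun f =>
    sum_comm' (by intro a b; simp only [mem_erase]; tauto)
  have hX : coeff q (X : PowerSeries K) = 0 := by rw [coeff_X, if_neg (by omega)]
  simp only [residueSum, sum_add_distrib, pow_zero, one_mul, mul_one, coeff_zero_X_mul,
    add_zero] at h1 hmp hm' hp'
  rw [hswap (fun k l => (-1) ^ p * _)] at h1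
  have hsq : (∑ l ∈ s, recip (x l - c) ^ m - C δm) * (∑ l ∈ s, recip (x l - c) ^ p - C δp)
      = ∑ k ∈ s, ∑ l ∈ s.erase k, recip (x k - c) ^ m * recip (x l - c) ^ p
        + ∑ k ∈ s, recip (x k - c) ^ (m + p) - C δm * ∑ k ∈ s, recip (x k - c) ^ p
        - C δp * ∑ k ∈ s, recip (x k - c) ^ m + C δm * C δp := by
    have : ∑ k ∈ s, ∑ l ∈ s.erase k, recip (x k - c) ^ m * recip (x l - c) ^ p
        + ∑ k ∈ s, recip (x k - c) ^ (m + p)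
        = (∑ l ∈ s, recip (x l - c) ^ m) * ∑ l ∈ s, recip (x l - c) ^ p := by
      rw [← sum_add_distrib, sum_mul_sum]
      refine sum_congr rfl fun k hk => ?_
      rw [pow_add, sum_erase_add _ _ hk]
    rw [this]; ring
  rw [hsq]
  have hA : ∀ (m p : ℕ) (δ : K),
      ∑ k ∈ s, coeff m (X * ((∑ l ∈ s.erase k, recip (x l - x k) ^ p - C δ)
          * recip (c - x k) ^ q))
        = ∑ k ∈ s, ∑ l ∈ s.erase k, coeff m (X * (recip (x l - x k) ^ p * recip (c - x k) ^ q))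
          - δ * ∑ k ∈ s, coeff m (X * recip (c - x k) ^ q) := by
    intro m p δ
    rw [mul_sum, ← sum_sub_distrib]
    refine sum_congr rfl fun k _ => ?_
    rw [sub_mul, mul_sub, map_sub, mul_left_comm X (C δ), coeff_C_mul, sum_mul, mul_sum, map_sum]
  have hB : coeff q (X * (∑ k ∈ s, ∑ l ∈ s.erase k, recip (x k - c) ^ m * recip (x l - c) ^ p
        + ∑ k ∈ s, recip (x k - c) ^ (m + p) - C δm * ∑ k ∈ s, recip (x k - c) ^ p
        - C δp * ∑ k ∈ s, recip (x k - c) ^ m + C δm * C δp))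
      = ∑ k ∈ s, ∑ l ∈ s.erase k, coeff q (X * (recip (x k - c) ^ m * recip (x l - c) ^ p))
        + ∑ k ∈ s, coeff q (X * recip (x k - c) ^ (m + p))
        - δm * ∑ k ∈ s, coeff q (X * recip (x k - c) ^ p)
        - δp * ∑ k ∈ s, coeff q (X * recip (x k - c) ^ m) := by
    simp only [mul_add, mul_sub, mul_left_comm X (C _), map_add, map_sub, coeff_C_mul, hX,
      mul_sum (a := X), map_sum, mul_comm X (C δp), mul_zero, add_zero]
  rw [hA, hA, hB]
  simp only [← mul_sum] at h1 hmp hm' hp'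
  linear_combination h1 + hmp - δp * hm' - δm * hp'

end Residues

/-! ### The truncated formula -/

section Truncation

open PowerSeries Finset

theorem H_eq_sum_range (n r : ℕ) : H n r = ∑ k ∈ range n, 1 / ((k + 1 : ℕ) : ℝ) ^ r := by
  induction n with
  | zero => simp [H]
  | succ n ih => rw [H, sum_Icc_succ_top (by omega), sum_range_succ, ← ih, H]

/-- The partial sum of the divergent series for `t̃(1)`. -/
def halfHarmonic (N : ℕ) : ℝ := ∑ n ∈ range N, 1 / (((n + 1 : ℕ) : ℝ) - 1 / 2)

/-- The constant subtracted from truncations at `N` of series with exponent `r`: it is nonzero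
only for `r = 1`, where it compensates the divergence. -/
def correction (N r : ℕ) : ℝ := if r = 1 then halfHarmonic N else 0

/-- The regularized truncation of `t̃(r)`; it vanishes for `r = 1`. -/
def tTrunc (N r : ℕ) : ℝ :=
  ∑ n ∈ range N, 1 / (((n + 1 : ℕ) : ℝ) - 1 / 2) ^ r - correction N r

/-- The truncation of `R_{a,b}`. -/
def RTrunc (N a b : ℕ) : ℝ := ∑ n ∈ range N, Rterm a b (n + 1)

/-- The regularized truncation of the double series of `ζ(a) t̃(b)` to the triangle
`j + n ≤ N`. -/
def zetaTTrunc (N a b : ℕ) : ℝ :=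
  ∑ n ∈ range N, (H (N - 1 - n) a - correction N a) / (((n + 1 : ℕ) : ℝ) - 1 / 2) ^ b

theorem sum_erase_one_div_sub_pow {N k : ℕ} (hk : k < N) (r : ℕ) :
    ∑ l ∈ (range N).erase k, 1 / (((l + 1 : ℕ) : ℝ) - ((k + 1 : ℕ) : ℝ)) ^ r
      = (-1) ^ r * H k r + H (N - 1 - k) r := by
  obtain ⟨d, rfl⟩ := Nat.exists_eq_add_of_lt hk
  have he : (range (k + d + 1)).erase k = range k ∪ Ico (k + 1) (k + d + 1) := by
    ext l; simp only [mem_erase, mem_range, mem_union, mem_Ico]; omega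
  have hd : Disjoint (range k) (Ico (k + 1) (k + d + 1)) := by
    rw [disjoint_left]; intro l; simp only [mem_range, mem_Ico]; omega
  rw [he, sum_union hd, sum_Ico_eq_sum_range, H_eq_sum_range, H_eq_sum_range, mul_sum,
    ← sum_range_reflect (fun l => 1 / (((l + 1 : ℕ) : ℝ) - ((k + 1 : ℕ) : ℝ)) ^ r),
    show k + d + 1 - (k + 1) = d by omega, show k + d + 1 - 1 - k = d by omega]
  congr 1
  · refine sum_congr rfl fun l hl => ?_
    rw [mem_range] at hl
    have : (((k - 1 - l + 1 : ℕ) : ℝ) - ((k + 1 : ℕ) : ℝ)) = -1 * ((l + 1 : ℕ) : ℝ) := by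
      rw [show k - 1 - l + 1 = k - l by omega, Nat.cast_sub hl.le]
      push_cast; ring
    rw [this, mul_pow, one_div, mul_inv, ← inv_pow]
    norm_num
  · refine sum_congr rfl fun l _ => ?_
    congr 2
    push_cast; ring

theorem natCast_succ_sub_half_pos (n : ℕ) : (0 : ℝ) < ((n + 1 : ℕ) : ℝ) - 1 / 2 := by
  push_cast
  have : (0 : ℝ) ≤ n := n.cast_nonneg
  linarith

theorem one_div_half_sub_pow (n s : ℕ) :
    1 / ((1 / 2 : ℝ) - ((n + 1 : ℕ) : ℝ)) ^ s
      = (-1) ^ s * (1 / (((n + 1 : ℕ) : ℝ) - 1 / 2) ^ s) := by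
  rw [show (1 / 2 : ℝ) - ((n + 1 : ℕ) : ℝ) = -1 * (((n + 1 : ℕ) : ℝ) - 1 / 2) by ring, mul_pow,
    one_div, mul_inv, ← inv_pow]
  norm_num

/-- The residues at the poles `1, …, N` of one of the two factors, in terms of the
transformation `λ_m`. -/
theorem sum_residues_integers (N : ℕ) {m p q : ℕ} (hm : 1 ≤ m) (hp : 1 ≤ p) (hq : 1 ≤ q) :
    (-1) ^ q * ((-1) ^ m * ∑ k ∈ range N, coeff m (X *
      ((∑ l ∈ (range N).erase k, recip (((l + 1 : ℕ) : ℝ) - ((k + 1 : ℕ) : ℝ)) ^ p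
        - C (correction N p)) * recip ((1 / 2 : ℝ) - ((k + 1 : ℕ) : ℝ)) ^ q)))
      = (-1) ^ (p - 1) * lam m (RTrunc N) p q
        - (-1) ^ p * lam m (fun a b => (-1) ^ a * zetaTTrunc N a b) p q := by
  obtain ⟨m, rfl⟩ := Nat.exists_eq_add_of_le' hm
  obtain ⟨p, rfl⟩ := Nat.exists_eq_add_of_le' hp
  have hR : (-1 : ℝ) ^ p * lam (m + 1) (RTrunc N) (p + 1) q
        - (-1) ^ (p + 1) * lam (m + 1) (fun a b => (-1) ^ a * zetaTTrunc N a b) (p + 1) q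
      = ∑ ij ∈ antidiagonal m, ∑ k ∈ range N,
        ((p + 1 + ij.1 - 1).choose ij.1 : ℝ) * ((q + ij.2 - 1).choose ij.2 : ℝ) *
          ((-1) ^ p * Rterm (p + 1 + ij.1) (q + ij.2) (k + 1) + (-1) ^ p * (-1) ^ (p + 1 + ij.1) *
            ((H (N - 1 - k) (p + 1 + ij.1) - correction N (p + 1 + ij.1)) /
              (((k + 1 : ℕ) : ℝ) - 1 / 2) ^ (q + ij.2))) := by
    rw [lam, lam, mul_sum, mul_sum, ← sum_sub_distrib, Nat.add_sub_cancel]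
    refine sum_congr rfl fun ij _ => ?_
    rw [← mul_sum, sum_add_distrib, ← mul_sum, ← mul_sum, RTrunc, zetaTTrunc]
    ring
  rw [Nat.add_sub_cancel, hR, sum_comm, mul_sum, mul_sum]
  refine sum_congr rfl fun k hk => ?_
  rw [mem_range] at hk
  rw [coeff_succ_X_mul, coeff_mul, mul_sum, mul_sum]
  refine sum_congr rfl fun ij hij => ?_
  have hx : ∀ l ∈ (range N).erase k, ((l + 1 : ℕ) : ℝ) - ((k + 1 : ℕ) : ℝ) ≠ 0 := by
    intro l hl
    rw [sub_ne_zero, Ne, Nat.cast_inj]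
    have := (mem_erase.1 hl).1
    omega
  have hc : (1 / 2 : ℝ) - ((k + 1 : ℕ) : ℝ) ≠ 0 :=
    sub_ne_zero.2 (sub_ne_zero.1 (natCast_succ_sub_half_pos k).ne').symm
  rw [correction, coeff_sum_recip_pow_sub _ hx (by omega), coeff_recip_pow hc hq,
    one_div_half_sub_pow, sum_erase_one_div_sub_pow hk, Rterm, Nat.add_sub_cancel, correction,
    ← mem_antidiagonal.1 hij]
  obtain ⟨i, j⟩ := ij
  have h1 : (-1 : ℝ) ^ (i * 2) = 1 := by rw [mul_comm, pow_mul]; norm_num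
  have h2 : (-1 : ℝ) ^ (j * 2) = 1 := by rw [mul_comm, pow_mul]; norm_num
  have h3 : (-1 : ℝ) ^ (p * 2) = 1 := by rw [mul_comm, pow_mul]; norm_num
  have h4 : (-1 : ℝ) ^ (q * 2) = 1 := by rw [mul_comm, pow_mul]; norm_num
  have hs : (-1 : ℝ) ^ q * (-1) ^ (i + j + 1) * (-1) ^ (q + j) = -(-1) ^ i := by
    ring_nf; rw [h2, h4]; ring
  have hs1 : -(-1 : ℝ) ^ i * (-1) ^ (p + 1 + i) = (-1) ^ p := by
    ring_nf; rw [h1]; ring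
  have hs2 : (-1 : ℝ) ^ p * (-1) ^ (p + 1 + i) = -(-1) ^ i := by
    ring_nf; rw [h3]; ring
  rw [hs2]
  dsimp only
  set Z : ℝ := if p + 1 + i = 1 then halfHarmonic N else 0
  set B : ℝ := ((p + 1 + i - 1).choose i : ℝ) * ((q + j - 1).choose j : ℝ)
  set V : ℝ := (((k + 1 : ℕ) : ℝ) - 1 / 2) ^ (q + j)
  linear_combination B / V * ((-1) ^ (p + 1 + i) * H k (p + 1 + i) + H (N - 1 - k) (p + 1 + i) - Z)
    * hs + B / V * H k (p + 1 + i) * hs1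

/-- The explicit formula with all series truncated at `N` and regularized. -/
theorem truncated_formula (N : ℕ) {m p q : ℕ} (hm : 1 ≤ m) (hp : 1 ≤ p) (hq : 2 ≤ q) :
    (-1 : ℝ) ^ (m - 1) * lam p (RTrunc N) m q + (-1 : ℝ) ^ (p - 1) * lam m (RTrunc N) p q
      = ((m + p + q - 2).choose (q - 1) : ℝ) * tTrunc N (m + p + q - 1)
        + (-1 : ℝ) ^ m * lam p (fun a b => (-1 : ℝ) ^ a * zetaTTrunc N a b) m q
        + (-1 : ℝ) ^ p * lam m (fun a b => (-1 : ℝ) ^ a * zetaTTrunc N a b) p q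
        - lam q (fun a b => tTrunc N a * tTrunc N b) m p := by
  have hx : Set.InjOn (fun n : ℕ => ((n + 1 : ℕ) : ℝ)) (range N : Finset ℕ) := by
    intro a _ b _ h
    simpa using h
  have hc : ∀ l ∈ range N, ((l + 1 : ℕ) : ℝ) ≠ 1 / 2 := fun l _ =>
    sub_ne_zero.1 (natCast_succ_sub_half_pos l).ne'
  have h := sum_residues_eq_zero (range N) hx hc hm hp hq (correction N m) (correction N p)
  have h1 := sum_residues_integers N hm hp (by omega : 1 ≤ q)
  have h2 := sum_residues_integers N hp hm (by omega : 1 ≤ q)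
  have h3 : (-1 : ℝ) ^ q * ((-1) ^ (m + p) * ∑ k ∈ range N,
      coeff (m + p) (X * recip ((1 / 2 : ℝ) - ((k + 1 : ℕ) : ℝ)) ^ q))
      = -(((m + p + q - 2).choose (q - 1) : ℝ) * tTrunc N (m + p + q - 1)) := by
    obtain ⟨r, hr⟩ : ∃ r, m + p = r + 1 := ⟨m + p - 1, by omega⟩
    obtain ⟨q, rfl⟩ := Nat.exists_eq_add_of_le' (by omega : 1 ≤ q)
    rw [tTrunc, correction, if_neg (by omega), sub_zero, hr, ← mul_assoc, mul_sum, mul_sum,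
      ← sum_neg_distrib]
    refine sum_congr rfl fun k hk => ?_
    rw [coeff_succ_X_mul, coeff_recip_pow (sub_ne_zero.2 (hc k hk).symm) (by omega),
      one_div_half_sub_pow, show q + 1 + r - 1 = q + r by omega,
      show r + 1 + (q + 1) - 2 = q + r by omega, Nat.add_sub_cancel,
      show r + 1 + (q + 1) - 1 = q + 1 + r by omega,
      ← Nat.choose_symm_of_eq_add (a := q) (b := r) rfl]
    have : (-1 : ℝ) ^ (q + 1) * (-1) ^ (r + 1) * (-1) ^ (q + 1 + r) = -1 := by
      rw [← pow_add, ← pow_add, Odd.neg_one_pow ⟨q + 1 + r, by ring⟩]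
    linear_combination ((q + r).choose q : ℝ) *
      (1 / (((k + 1 : ℕ) : ℝ) - 1 / 2) ^ (q + 1 + r)) * this
  have h4 : coeff q (X * ((∑ l ∈ range N, recip (((l + 1 : ℕ) : ℝ) - 1 / 2) ^ m
        - C (correction N m)) * (∑ l ∈ range N, recip (((l + 1 : ℕ) : ℝ) - 1 / 2) ^ p
        - C (correction N p)))) = lam q (fun a b => tTrunc N a * tTrunc N b) m p := by
    obtain ⟨q, rfl⟩ := Nat.exists_eq_add_of_le' (by omega : 1 ≤ q)
    rw [coeff_succ_X_mul, coeff_mul, lam, Nat.add_sub_cancel]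
    refine sum_congr rfl fun ij _ => ?_
    rw [correction, correction,
      coeff_sum_recip_pow_sub _ (fun l _ => (natCast_succ_sub_half_pos l).ne') hm,
      coeff_sum_recip_pow_sub _ (fun l _ => (natCast_succ_sub_half_pos l).ne') hp]
    simp only [tTrunc, correction]
    ring
  rw [h4] at h
  have hs : (-1 : ℝ) ^ q * (-1) ^ q = 1 := by rw [← mul_pow]; norm_num
  linear_combination (-1) ^ q * h - h1 - h2 - h3 -
    lam q (fun a b => tTrunc N a * tTrunc N b) m p * hs

end Truncation

section Limit

open Finset Filter Topology

/-! ### Convergence of the series -/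

theorem H_nonneg (n r : ℕ) : 0 ≤ H n r := sum_nonneg fun k _ => by positivity

theorem H_le_H_one (n : ℕ) {r : ℕ} (hr : 1 ≤ r) : H n r ≤ H n 1 := by
  refine sum_le_sum fun k hk => ?_
  have hk1 : (1 : ℝ) ≤ k := by exact_mod_cast (mem_Icc.1 hk).1
  exact one_div_le_one_div_of_le (by positivity) (pow_le_pow_right₀ hk1 hr)

/-- An elementary bound, sufficient for the summability of `H_n / n ^ s` with `s ≥ 2`. -/
theorem H_one_le_two_mul_sqrt (n : ℕ) : H n 1 ≤ 2 * √n := by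
  induction n with
  | zero => simp [H]
  | succ n ih =>
    rw [H_eq_sum_range, sum_range_succ, ← H_eq_sum_range, pow_one]
    have hn : (0 : ℝ) ≤ n := n.cast_nonneg
    have h1 : √((n + 1 : ℕ) : ℝ) ^ 2 = n + 1 := by
      rw [Real.sq_sqrt (by positivity)]; push_cast; ring
    have h0 : √(n : ℝ) ^ 2 = n := Real.sq_sqrt hn
    have hpos : 0 < √((n + 1 : ℕ) : ℝ) := Real.sqrt_pos.2 (by positivity)
    have h3 : 1 / ((n + 1 : ℕ) : ℝ) ≤ 2 * (√((n + 1 : ℕ) : ℝ) - √(n : ℝ)) := by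
      rw [div_le_iff₀ (by positivity)]
      push_cast at *
      have := Real.sqrt_nonneg (n : ℝ)
      have hle : √(n : ℝ) ≤ √((n : ℝ) + 1) := Real.sqrt_le_sqrt (by linarith)
      nlinarith [sq_nonneg (√((n : ℝ) + 1) - √(n : ℝ)), mul_nonneg (sub_nonneg.2 hle) this]
    linarith

theorem summable_H_one_div_pow {s : ℕ} (hs : 2 ≤ s) :
    Summable fun n : ℕ => H (n + 1) 1 / (((n + 1 : ℕ) : ℝ) - 1 / 2) ^ s := by
  have h0 : Summable fun n : ℕ => 1 / ((n + 1 : ℕ) : ℝ) ^ (3 / 2 : ℝ) :=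
    (summable_nat_add_iff 1).2 (Real.summable_one_div_nat_rpow.2 (by norm_num))
  refine Summable.of_nonneg_of_le (fun n => ?_) (fun n => ?_) (h0.mul_left (2 ^ s * 2))
  · exact div_nonneg (H_nonneg _ _) (pow_pos (natCast_succ_sub_half_pos n) s).le
  · set x : ℝ := ((n + 1 : ℕ) : ℝ) with hx
    have hx1 : 1 ≤ x := by rw [hx]; push_cast; linarith [(n.cast_nonneg : (0 : ℝ) ≤ n)]
    have hx0 : 0 < x := by linarith
    have h1 : (x / 2) ^ s ≤ (x - 1 / 2) ^ s := pow_le_pow_left₀ (by positivity) (by linarith) s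
    have h2 : √x / x ^ 2 = 1 / x ^ (3 / 2 : ℝ) := by
      rw [div_eq_div_iff (by positivity) (by positivity), Real.sqrt_eq_rpow, ← Real.rpow_add hx0,
        one_mul, ← Real.rpow_natCast]
      norm_num
    calc H (n + 1) 1 / (x - 1 / 2) ^ s ≤ 2 * √x / (x / 2) ^ s :=
          div_le_div₀ (by positivity) (H_one_le_two_mul_sqrt _) (by positivity) h1
      _ = 2 ^ s * 2 * (√x / x ^ s) := by rw [div_pow]; field_simp
      _ ≤ 2 ^ s * 2 * (√x / x ^ 2) := by
          gcongr
      _ = _ := by rw [h2]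

theorem one_le_H_succ_one (n : ℕ) : 1 ≤ H (n + 1) 1 := by
  rw [H_eq_sum_range, sum_range_succ']
  simp only [zero_add, Nat.cast_one, one_pow, div_one, le_add_iff_nonneg_left]
  positivity

theorem summable_one_div_sub_half_pow {s : ℕ} (hs : 2 ≤ s) :
    Summable fun n : ℕ => 1 / (((n + 1 : ℕ) : ℝ) - 1 / 2) ^ s := by
  refine Summable.of_nonneg_of_le (fun n => ?_) (fun n => ?_) (summable_H_one_div_pow hs)
  · exact div_nonneg zero_le_one (pow_pos (natCast_succ_sub_half_pos n) s).le
  · exact div_le_div_of_nonneg_right (one_le_H_succ_one n)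
      (pow_pos (natCast_succ_sub_half_pos n) s).le

theorem H_mono {n k : ℕ} (h : n ≤ k) (r : ℕ) : H n r ≤ H k r :=
  sum_le_sum_of_subset_of_nonneg (Icc_subset_Icc_right h) fun _ _ _ => by positivity

theorem summable_Rterm {a b : ℕ} (ha : 1 ≤ a) (hb : 2 ≤ b) :
    Summable fun n : ℕ => Rterm a b (n + 1) := by
  refine Summable.of_nonneg_of_le (fun n => ?_) (fun n => ?_) (summable_H_one_div_pow hb)
  · exact div_nonneg (H_nonneg _ _) (pow_pos (natCast_succ_sub_half_pos n) b).le
  · rw [Rterm, Nat.add_sub_cancel]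
    exact div_le_div_of_nonneg_right ((H_le_H_one n ha).trans (H_mono n.le_succ 1))
      (pow_pos (natCast_succ_sub_half_pos n) b).le

/-! ### Limits of the truncations -/

theorem zetaValue_eq_tsum {s : ℕ} (hs : 2 ≤ s) : zetaValue s = ∑' n : ℕ, 1 / (n : ℝ) ^ s := by
  apply Complex.ofReal_injective
  rw [ofReal_zetaValue hs, zeta_nat_eq_tsum_of_gt_one (by omega)]
  push_cast
  rfl

theorem H_one_eq_harmonic (n : ℕ) : H n 1 = (harmonic n : ℝ) := by
  rw [H_eq_sum_range, harmonic]
  push_cast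
  simp

theorem halfHarmonic_eq (N : ℕ) : halfHarmonic N = 2 * H (2 * N) 1 - H N 1 := by
  simp only [halfHarmonic, H_eq_sum_range]
  induction N with
  | zero => simp
  | succ n ih =>
    rw [show 2 * (n + 1) = 2 * n + 1 + 1 by ring, sum_range_succ, ih, sum_range_succ _ (2 * n + 1),
      sum_range_succ _ (2 * n), sum_range_succ _ n]
    push_cast
    have h1 : ((n : ℝ) + 1 - 1 / 2) ≠ 0 := by
      have := natCast_succ_sub_half_pos n
      push_cast at this
      exact this.ne'
    have h2 : (2 * (n : ℝ) + 1) ≠ 0 := by positivity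
    have h3 : ((n : ℝ) + 1 - 1 / 2) = (2 * (n : ℝ) + 1) / 2 := by ring
    rw [h3]
    field_simp
    ring

/-- The regularized truncations of `ζ(r)` converge; for `r = 1` this is where the convention
`ζ(1) = -2 ln 2` comes from. -/
theorem tendsto_H_sub_correction {r : ℕ} (hr : 1 ≤ r) :
    Tendsto (fun N => H N r - correction N r) atTop (𝓝 (zeta r)) := by
  by_cases h1 : r = 1
  · subst h1
    rw [zeta, if_pos rfl]
    have hγ := Real.tendsto_harmonic_sub_log
    have h2 : Tendsto (fun N : ℕ => 2 * N) atTop atTop :=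
      tendsto_id.const_mul_atTop' (by norm_num)
    have h := (((hγ.sub (hγ.comp h2)).const_mul 2).add_const (-2 * Real.log 2))
    rw [sub_self, mul_zero, zero_add] at h
    refine h.congr' ?_
    filter_upwards [eventually_ge_atTop 1] with N hN
    have hN' : (N : ℝ) ≠ 0 := by positivity
    simp only [Function.comp, correction, if_true, halfHarmonic_eq, H_one_eq_harmonic]
    push_cast
    rw [Real.log_mul two_ne_zero hN']
    ring
  · have hs : Summable fun n : ℕ => 1 / (n : ℝ) ^ r :=
      Real.summable_one_div_nat_pow.2 (by omega)
    rw [zeta, if_neg h1, zetaValue_eq_tsum (by omega)]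
    refine (hs.hasSum.tendsto_sum_nat.comp (tendsto_add_atTop_nat 1)).congr fun N => ?_
    -- the term at `0` of the zeta series is the junk value `1 / 0 = 0`
    rw [correction, if_neg h1, sub_zero, H_eq_sum_range, Function.comp, sum_range_succ']
    simp [show r ≠ 0 by omega]

theorem tendsto_tTrunc {r : ℕ} (hr : 1 ≤ r) :
    Tendsto (fun N => tTrunc N r) atTop (𝓝 (tTilde r)) := by
  by_cases h1 : r = 1
  · subst h1
    simp [tTrunc, tTilde, correction, halfHarmonic]
  · simp only [tTrunc, tTilde, correction, if_neg h1, sub_zero]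
    exact (summable_one_div_sub_half_pow (by omega)).hasSum.tendsto_sum_nat

theorem tendsto_RTrunc {a b : ℕ} (ha : 1 ≤ a) (hb : 2 ≤ b) :
    Tendsto (fun N => RTrunc N a b) atTop (𝓝 (R a b)) :=
  (summable_Rterm ha hb).hasSum.tendsto_sum_nat

theorem H_add (d k r : ℕ) :
    H (d + k) r = H d r + ∑ j ∈ range k, 1 / ((d + j + 1 : ℕ) : ℝ) ^ r := by
  rw [H_eq_sum_range, H_eq_sum_range, sum_range_add]

/-- A block of `k` consecutive terms is at most the block of the first `k` terms of exponent `1`.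
The bound does not depend on the start `d` of the block. -/
theorem H_add_sub_le (d k : ℕ) {r : ℕ} (hr : 1 ≤ r) : H (d + k) r - H d r ≤ H k 1 := by
  rw [H_add, add_sub_cancel_left, H_eq_sum_range]
  refine sum_le_sum fun j _ => one_div_le_one_div_of_le (by positivity) ?_
  have h1 : ((j + 1 : ℕ) : ℝ) ≤ ((d + j + 1 : ℕ) : ℝ) := by exact_mod_cast (by omega)
  have h2 : (1 : ℝ) ≤ ((d + j + 1 : ℕ) : ℝ) := by exact_mod_cast (by omega)
  calc ((j + 1 : ℕ) : ℝ) ^ 1 ≤ ((d + j + 1 : ℕ) : ℝ) ^ 1 := by rwa [pow_one, pow_one]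
    _ ≤ _ := pow_le_pow_right₀ h2 hr

theorem tendsto_H_sub {r : ℕ} (hr : 1 ≤ r) (n : ℕ) :
    Tendsto (fun N => H (N - 1 - n) r - correction N r) atTop (𝓝 (zeta r)) := by
  have hj : ∀ j ∈ range (n + 1), Tendsto
      (fun N : ℕ => 1 / (((N - 1 - n) + j + 1 : ℕ) : ℝ) ^ r) atTop (𝓝 0) := by
    intro j _
    have h1 : Tendsto (fun N : ℕ => 1 / (N : ℝ) ^ r) atTop (𝓝 0) := by
      simpa [Function.comp_def] using (tendsto_inv_atTop_zero.comp
        ((tendsto_pow_atTop (by omega : r ≠ 0)).comp (tendsto_natCast_atTop_atTop (R := ℝ))))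
    refine h1.comp (tendsto_atTop_mono (fun N => ?_) (tendsto_sub_atTop_nat (1 + n)))
    omega
  have h := (tendsto_H_sub_correction hr).sub (tendsto_finsetSum _ hj)
  rw [sum_const_zero, sub_zero] at h
  refine h.congr' ?_
  filter_upwards [eventually_gt_atTop n] with N hN
  have := H_add (N - 1 - n) (n + 1) r
  rw [show N - 1 - n + (n + 1) = N by omega] at this
  rw [this]; ring

theorem tendsto_zetaTTrunc {a b : ℕ} (ha : 1 ≤ a) (hb : 2 ≤ b) :
    Tendsto (fun N => zetaTTrunc N a b) atTop (𝓝 (zeta a * tTilde b)) := by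
  obtain ⟨M, hM⟩ := (tendsto_H_sub_correction ha).abs.bddAbove_range
  have hM' : ∀ N, |H N a - correction N a| ≤ M := fun N => hM ⟨N, rfl⟩
  rw [tTilde, if_neg (by omega), ← tsum_mul_left]
  have hsum : ∀ N, zetaTTrunc N a b = ∑' n : ℕ, if n < N then
      (H (N - 1 - n) a - correction N a) / (((n + 1 : ℕ) : ℝ) - 1 / 2) ^ b else 0 := by
    intro N
    rw [tsum_eq_sum (s := range N) (fun n hn => if_neg (by simpa using hn)), zetaTTrunc]
    exact sum_congr rfl fun n hn => (if_pos (by simpa using hn)).symm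
  simp only [hsum]
  -- `H (N - 1 - n) a` differs from `H N a` by at most `H (n + 1) 1`, uniformly in `N`
  refine tendsto_tsum_of_dominated_convergence (bound := fun n : ℕ =>
    M * (1 / (((n + 1 : ℕ) : ℝ) - 1 / 2) ^ b) + H (n + 1) 1 / (((n + 1 : ℕ) : ℝ) - 1 / 2) ^ b)
    (((summable_one_div_sub_half_pow hb).mul_left M).add (summable_H_one_div_pow hb))
    (fun n => ?_) (Eventually.of_forall fun N n => ?_)
  · rw [mul_one_div]
    refine ((tendsto_H_sub ha n).div_const _).congr' ?_
    filter_upwards [eventually_gt_atTop n] with N hN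
    rw [if_pos hN]
  · have hpos := pow_pos (natCast_succ_sub_half_pos n) b
    have hM0 : 0 ≤ M := (abs_nonneg _).trans (hM' 0)
    split_ifs with h
    · rw [norm_div, Real.norm_of_nonneg hpos.le, mul_one_div, ← add_div]
      refine div_le_div_of_nonneg_right ?_ hpos.le
      have h1 := H_add_sub_le (N - 1 - n) (n + 1) ha
      have h2 := H_mono (by omega : N - 1 - n ≤ N) a
      rw [show N - 1 - n + (n + 1) = N by omega] at h1
      have h3 := abs_le.1 (hM' N)
      have h4 := H_nonneg (n + 1) 1
      rw [Real.norm_eq_abs, abs_le]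
      constructor <;> linarith
    · rw [norm_zero]
      have := H_nonneg (n + 1) 1
      positivity

theorem tendsto_lam {Ω : ℕ → ℕ → ℕ → ℝ} {Ω' : ℕ → ℕ → ℝ} (m : ℕ) {p q : ℕ}
    (h : ∀ a b, p ≤ a → q ≤ b → Tendsto (fun N => Ω N a b) atTop (𝓝 (Ω' a b))) :
    Tendsto (fun N => lam m (Ω N) p q) atTop (𝓝 (lam m Ω' p q)) :=
  tendsto_finsetSum _ fun _ _ => (h _ _ (Nat.le_add_right _ _) (Nat.le_add_right _ _)).const_mul _

/-! ### Membership in the ring -/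

theorem tTilde_eq_zetaValue {s : ℕ} (hs : 2 ≤ s) : tTilde s = (2 ^ s - 1) * zetaValue s := by
  have hz : Summable fun n : ℕ => 1 / (n : ℝ) ^ s := Real.summable_one_div_nat_pow.2 (by omega)
  have he : Summable fun n : ℕ => 1 / ((2 * n : ℕ) : ℝ) ^ s :=
    hz.comp_injective (i := fun n => 2 * n) (mul_right_injective₀ two_ne_zero)
  have ho : Summable fun n : ℕ => 1 / ((2 * n + 1 : ℕ) : ℝ) ^ s :=
    hz.comp_injective (i := fun n => 2 * n + 1) fun a b h => by
      simp only at h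
      omega
  have h := tsum_even_add_odd (f := fun n : ℕ => 1 / (n : ℝ) ^ s) he ho
  have h1 : ∑' n : ℕ, 1 / ((2 * n : ℕ) : ℝ) ^ s = (1 / 2 ^ s) * ∑' n : ℕ, 1 / (n : ℝ) ^ s := by
    rw [← tsum_mul_left]
    refine tsum_congr fun n => ?_
    push_cast
    rw [mul_pow, one_div_mul_one_div]
  have h2 : tTilde s = 2 ^ s * ∑' n : ℕ, 1 / ((2 * n + 1 : ℕ) : ℝ) ^ s := by
    rw [tTilde, if_neg (by omega), ← tsum_mul_left]
    refine tsum_congr fun n => ?_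
    rw [show (((n + 1 : ℕ) : ℝ) - 1 / 2) = ((2 * n + 1 : ℕ) : ℝ) / 2 by push_cast; ring, div_pow]
    field_simp
  rw [h2, zetaValue_eq_tsum hs]
  rw [h1] at h
  have h2s : (2 : ℝ) ^ s * (1 / 2 ^ s) = 1 := by field_simp
  linear_combination 2 ^ s * h - h2s * ∑' n : ℕ, 1 / (n : ℝ) ^ s

theorem zetaValue_mem {s : ℕ} (hs : 2 ≤ s) : zetaValue s ∈ logZetaRing :=
  Algebra.subset_adjoin (Or.inr ⟨s, hs, rfl⟩)

theorem zeta_mem {s : ℕ} (hs : 1 ≤ s) : zeta s ∈ logZetaRing := by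
  rw [zeta]
  split_ifs with h
  · exact mul_mem (by exact_mod_cast intCast_mem logZetaRing (-2))
      (Algebra.subset_adjoin (Or.inl rfl))
  · exact zetaValue_mem (by omega)

theorem tTilde_mem {s : ℕ} (hs : 1 ≤ s) : tTilde s ∈ logZetaRing := by
  by_cases h : s = 1
  · simp [tTilde, h]
  · rw [tTilde_eq_zetaValue (by omega)]
    exact mul_mem (sub_mem (pow_mem (by exact_mod_cast natCast_mem logZetaRing 2) _) (one_mem _))
      (zetaValue_mem (by omega))

theorem neg_one_pow_mem (n : ℕ) : (-1 : ℝ) ^ n ∈ logZetaRing :=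
  pow_mem (neg_mem (one_mem _)) n

theorem lam_mem {Ω : ℕ → ℕ → ℝ} (m : ℕ) {p q : ℕ}
    (h : ∀ a b, p ≤ a → q ≤ b → Ω a b ∈ logZetaRing) : lam m Ω p q ∈ logZetaRing :=
  sum_mem fun _ _ => mul_mem (mul_mem (natCast_mem _ _) (natCast_mem _ _))
    (h _ _ (Nat.le_add_right _ _) (Nat.le_add_right _ _))

/-! ### The explicit formula -/

theorem explicit_formula {m p q : ℕ} (hm : 1 ≤ m) (hp : 1 ≤ p) (hq : 2 ≤ q) :
    (-1 : ℝ) ^ (m - 1) * lam p R m q + (-1 : ℝ) ^ (p - 1) * lam m R p q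
      = ((m + p + q - 2).choose (q - 1) : ℝ) * tTilde (m + p + q - 1)
        + (-1 : ℝ) ^ m * lam p (fun a b => (-1 : ℝ) ^ a * zeta a * tTilde b) m q
        + (-1 : ℝ) ^ p * lam m (fun a b => (-1 : ℝ) ^ a * zeta a * tTilde b) p q
        - lam q (fun a b => tTilde a * tTilde b) m p := by
  have hR : ∀ m p : ℕ, 1 ≤ p → Tendsto (fun N => lam m (RTrunc N) p q) atTop
      (𝓝 (lam m R p q)) := fun m p hp =>
    tendsto_lam m fun a b ha hb => tendsto_RTrunc (by omega) (by omega)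
  have hZ : ∀ m p : ℕ, 1 ≤ p → Tendsto
      (fun N => lam m (fun a b => (-1 : ℝ) ^ a * zetaTTrunc N a b) p q) atTop
      (𝓝 (lam m (fun a b => (-1 : ℝ) ^ a * zeta a * tTilde b) p q)) := fun m p hp =>
    tendsto_lam m fun a b ha hb => by
      simpa only [mul_assoc] using
        (tendsto_zetaTTrunc (by omega : 1 ≤ a) (by omega : 2 ≤ b)).const_mul ((-1 : ℝ) ^ a)
  have hT : Tendsto (fun N => lam q (fun a b => tTrunc N a * tTrunc N b) m p) atTop
      (𝓝 (lam q (fun a b => tTilde a * tTilde b) m p)) :=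
    tendsto_lam q fun a b ha hb => (tendsto_tTrunc (by omega)).mul (tendsto_tTrunc (by omega))
  refine tendsto_nhds_unique_of_eventuallyEq
    (((hR p m hm).const_mul _).add ((hR m p hp).const_mul _))
    (((((tendsto_tTrunc (by omega : 1 ≤ m + p + q - 1)).const_mul _).add
      ((hZ p m hm).const_mul _)).add ((hZ m p hp).const_mul _)).sub hT)
    (Eventually.of_forall fun N => truncated_formula N hm hp hq)

end Limit

end EulerR

end

theorem theorem4p1 (m p q : ℕ) (hm : 1 ≤ m) (hp : 1 ≤ p) (hq : 2 ≤ q) :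
    -- the series that define the `R`-sums converge
    (∀ a b : ℕ, 1 ≤ a → 2 ≤ b → Summable (fun n : ℕ => EulerR.Rterm a b (n + 1))) ∧
    -- reducibility to `ln 2` and zeta values
    (-1 : ℝ) ^ (m - 1) * EulerR.lam p EulerR.R m q
        + (-1 : ℝ) ^ (p - 1) * EulerR.lam m EulerR.R p q ∈ EulerR.logZetaRing ∧
    -- the explicit expression
    (-1 : ℝ) ^ (m - 1) * EulerR.lam p EulerR.R m q
        + (-1 : ℝ) ^ (p - 1) * EulerR.lam m EulerR.R p q
      = ((m + p + q - 2).choose (q - 1) : ℝ) * EulerR.tTilde (m + p + q - 1)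
        + (-1 : ℝ) ^ m *
            EulerR.lam p (fun a b => (-1 : ℝ) ^ a * EulerR.zeta a * EulerR.tTilde b) m q
        + (-1 : ℝ) ^ p *
            EulerR.lam m (fun a b => (-1 : ℝ) ^ a * EulerR.zeta a * EulerR.tTilde b) p q
        - EulerR.lam q (fun a b => EulerR.tTilde a * EulerR.tTilde b) m p := by
  refine ⟨fun a b => EulerR.summable_Rterm, ?_, EulerR.explicit_formula hm hp hq⟩
  rw [EulerR.explicit_formula hm hp hq]
  have hZ : ∀ k r : ℕ, 1 ≤ r → (-1 : ℝ) ^ r *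
      EulerR.lam k (fun a b => (-1 : ℝ) ^ a * EulerR.zeta a * EulerR.tTilde b) r q
        ∈ EulerR.logZetaRing := fun k r hr =>
    mul_mem (EulerR.neg_one_pow_mem r) (EulerR.lam_mem k fun a b ha hb =>
      mul_mem (mul_mem (EulerR.neg_one_pow_mem a) (EulerR.zeta_mem (by omega)))
        (EulerR.tTilde_mem (by omega)))
  exact sub_mem (add_mem (add_mem
    (mul_mem (natCast_mem _ _) (EulerR.tTilde_mem (by omega))) (hZ p m hm)) (hZ m p hp))
    (EulerR.lam_mem q fun a b ha hb =>
      mul_mem (EulerR.tTilde_mem (by omega)) (EulerR.tTilde_mem (by omega)))
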